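/- Let $K$ be a field, $r\in\mathbb N$, and let $\mathbf R^r=[0,\infty)^r$ be partially ordered component-wise. A persistence module is a functor from the poset $\mathbf R^r$ to $K$-vector spaces; it is \emph{tame} if it is finitely presented, i.e. if there is an exact sequence $F_1\to F_0\to M\to 0$ with $F_0,F_1$ free of finite rank, where a free module of rank $n$ is a direct sum $\bigoplus_{i=1}^n K(g_i,\bullet)$ with $K(g,h)=K$ if $g\le h$ and $0$ otherwise. For a tame module $M$, let $\beta_0(M)$ be the smallest rank of a free persistence module surjecting onto $M$. For $u\in\mathbf R^r$, the \emph{shift-dimension} $\dim_u(M)$ is the smallest $k$ such that there are homogeneous elements $m_1,\dots,m_k$ of $M$ with $u*(M/\langle m_1,\dots,m_k\rangle)=0$, i.e. such that all maps $(M/\langle m_1,\dots,m_k\rangle)(a)\to (M/\langle m_1,\dots,m_k\rangle)(a+u)$, $a\in\mathbf R^r$, vanish. Let $0\neq w\in\mathbf R^r$ and $v=w/\|w\|$, where $\|\cdot\|$ is any norm on $\mathbb R^r$. The \emph{standard noise} in the direction of $v$ is the noise system of the standard contour $C(x,\varepsilon)=x+\varepsilon v$, namely $$\mathcal V_\varepsilon=\{N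 \text{ tame} \mid N(a\le a+\varepsilon v)=0 \text{ for all } a\in\mathbf R^r\},\qquad \varepsilon\ge 0 .$$ A morphism $f$ of tame modules is an \emph{$\varepsilon$-equivalence} with respect to this noise system if $\ker f\in\mathcal V_a$ and $\operatorname{coker} f\in\mathcal V_b$ for some $a,b\ge 0$ with $a+b\le\varepsilon$. Tame modules $M,N$ are \emph{$\varepsilon$-equivalent} if there are a tame module $L$, an $\varepsilon_1$-equivalence $M\to L$ and an $\varepsilon_2$-equivalence $N\to L$ with $\varepsilon_1+\varepsilon_2\le\varepsilon$. Let $d(M,N)\in[0,\infty]$ be the infimum of all $\varepsilon\geq 0$ such that $M$ and $N$ are $\varepsilon$-equivalent ($\infty$ if there is none). Then the hierarchical stabilization $\widehat{\beta_0}$ of $\beta_0$ with respect to $d$ satisfies, for every tame module $M$ and every $\delta\ge 0$, $$\widehat{\beta_0}(M)(\delta)\;:=\;\min\{\beta_0(N)\mid N\text{ tame},\ d(M,N)\le\delta\}\;=\;\dim_{\delta v}(M).$$ -/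

import Mathlib

open CategoryTheory
open scoped NNReal ENNReal

universe u

namespace MultiPers

/-- The poset `𝐑^r = [0, ∞)^r` with the component-wise order, addition and scaling. It is a `def`
so that its category structure is the one of the poset, not the product of categories. -/
def Grade (r : ℕ) : Type := Fin r → ℝ≥0

noncomputable instance (r : ℕ) : AddCommMonoid (Grade r) :=
  inferInstanceAs (AddCommMonoid (Fin r → ℝ≥0))

instance (r : ℕ) : PartialOrder (Grade r) := inferInstanceAs (PartialOrder (Fin r → ℝ≥0))

instance (r : ℕ) : IsOrderedAddMonoid (Grade r) :=
  inferInstanceAs (IsOrderedAddMonoid (Fin r → ℝ≥0))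

instance (r : ℕ) : CanonicallyOrderedAdd (Grade r) :=
  inferInstanceAs (CanonicallyOrderedAdd (Fin r → ℝ≥0))

noncomputable instance (r : ℕ) : Module ℝ≥0 (Grade r) :=
  inferInstanceAs (Module ℝ≥0 (Fin r → ℝ≥0))

/-- Persistence modules over `𝐑^r`: functors from the poset `𝐑^r` to `K`-vector spaces. -/
abbrev PersMod (K : Type u) [Field K] (r : ℕ) : Type (u + 1) := Grade r ⥤ ModuleCat.{u} K

section Modules

variable {K : Type u} [Field K] {r : ℕ}

/-- The value at `h` of the free module `⨁ i, K(g i, •)`: families of scalars whose `i`-th entry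
is arbitrary if `g i ≤ h` and zero otherwise. -/
def freeFiber (K : Type u) [Field K] {r n : ℕ} (g : Fin n → Grade r) (h : Grade r) :
    Submodule K (Fin n → K) where
  carrier := {c | ∀ i, ¬ g i ≤ h → c i = 0}
  add_mem' := by
    intro a b ha hb i hi
    simp [ha i hi, hb i hi]
  zero_mem' := by
    intro i _
    rfl
  smul_mem' := by
    intro c a ha i hi
    simp [ha i hi]

theorem freeFiber_mono {n : ℕ} (g : Fin n → Grade r) {h h' : Grade r} (hh : h ≤ h') :
    freeFiber K g h ≤ freeFiber K g h' :=
  fun _ hc i hi => hc i fun hg => hi (hg.trans hh)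

/-- The free persistence module `⨁ i, K(g i, •)` of rank `n`, with one homogeneous free generator
in each of the degrees `g 0, …, g (n - 1)`. -/
def freeMod (K : Type u) [Field K] {r n : ℕ} (g : Fin n → Grade r) : PersMod K r where
  obj h := ModuleCat.of K (freeFiber K g h)
  map f := ModuleCat.ofHom (Submodule.inclusion (freeFiber_mono g (leOfHom f)))
  map_id _ := rfl
  map_comp _ _ := rfl

/-- A morphism of persistence modules is surjective if all of its components are. -/
def IsSurj {M N : PersMod K r} (f : M ⟶ N) : Prop :=
  ∀ h : Grade r, Function.Surjective (f.app h).hom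

/-- Tame persistence modules: the finitely presented ones, i.e. those with an exact sequence
`F₁ ⟶ F₀ ⟶ M ⟶ 0` where `F₀` and `F₁` are free of finite rank. -/
def IsTame (M : PersMod K r) : Prop :=
  ∃ (n m : ℕ) (g : Fin n → Grade r) (g' : Fin m → Grade r)
    (q : freeMod K g' ⟶ freeMod K g) (p : freeMod K g ⟶ M),
    IsSurj p ∧ ∀ h : Grade r, LinearMap.range (q.app h).hom = LinearMap.ker (p.app h).hom

/-- The tame persistence modules over `𝐑^r`. -/
def TameMod (K : Type u) [Field K] (r : ℕ) : Type (u + 1) := {M : PersMod K r // IsTame M}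

/-- The zeroth total multigraded Betti number of `M`: the smallest rank of a free persistence
module that surjects onto `M`. -/
noncomputable def betti0 (M : PersMod K r) : ℕ :=
  sInf {n : ℕ | ∃ (g : Fin n → Grade r) (p : freeMod K g ⟶ M), IsSurj p}

/-- Persistence submodules (subfunctors) of `M`. -/
structure PersSub (M : PersMod K r) where
  /-- the subspace in degree `h` -/
  fiber : ∀ h : Grade r, Submodule K (M.obj h)
  fiber_le_comap : ∀ {h h' : Grade r} (f : h ⟶ h'),
    fiber h ≤ (fiber h').comap (M.map f).hom

/-- The quotient persistence module `M / U`. -/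
def PersSub.quotient {M : PersMod K r} (U : PersSub M) : PersMod K r where
  obj h := ModuleCat.of K (M.obj h ⧸ U.fiber h)
  map {h h'} f := ModuleCat.ofHom
    (Submodule.mapQ (U.fiber h) (U.fiber h') (M.map f).hom (U.fiber_le_comap f))
  map_id h := by
    ext x
    simp
  map_comp f f' := by
    ext x
    simp

/-- The submodule `⟨m₁, …, m_k⟩` of `M` generated by homogeneous elements `m i` of degree `g i`:
in degree `h` it is spanned by the images of those `m i` with `g i ≤ h`. -/
def generated (M : PersMod K r) {k : ℕ} (g : Fin k → Grade r) (m : ∀ i, M.obj (g i)) :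
    PersSub M where
  fiber h := Submodule.span K {y | ∃ (i : Fin k) (hi : g i ≤ h), y = M.map (homOfLE hi) (m i)}
  fiber_le_comap {h h'} f := by
    rw [Submodule.span_le]
    rintro y ⟨i, hi, rfl⟩
    refine Submodule.subset_span ⟨i, hi.trans (leOfHom f), ?_⟩
    change (M.map f) (M.map (homOfLE hi) (m i)) = _
    rw [← ConcreteCategory.comp_apply, ← M.map_comp]
    rfl

/-- `v ∗ M = 0`: the action of `v` on `M`, which sends `M(a)` to `M(a + v)`, is zero. -/
def ShiftZero (v : Grade r) (M : PersMod K r) : Prop :=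
  ∀ a : Grade r, M.map (homOfLE (le_self_add : a ≤ a + v)) = 0

/-- Homogeneous elements `m₁, …, m_k` `v`-generate `M` if `v ∗ (M / ⟨m₁, …, m_k⟩) = 0`. -/
def VGenerate (v : Grade r) (M : PersMod K r) {k : ℕ} (g : Fin k → Grade r)
    (m : ∀ i, M.obj (g i)) : Prop :=
  ShiftZero v (generated M g m).quotient

/-- The shift-dimension `dim_v(M)`: the smallest number of homogeneous elements that
`v`-generate `M`. -/
noncomputable def shiftDim (v : Grade r) (M : PersMod K r) : ℕ :=
  sInf {k : ℕ | ∃ (g : Fin k → Grade r) (m : ∀ i, M.obj (g i)), VGenerate v M g m}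

end Modules

/-- Persistence contours: functors `C : 𝐑^r_∞ × 𝐑 → 𝐑^r_∞` with `x ≤ C(x, ε)` and
`C(C(x, ε), τ) ≤ C(x, ε + τ)`. -/
structure Contour (r : ℕ) where
  /-- the underlying map -/
  toFun : WithTop (Grade r) → ℝ≥0 → WithTop (Grade r)
  mono : ∀ {x y : WithTop (Grade r)} {ε τ : ℝ≥0}, x ≤ y → ε ≤ τ → toFun x ε ≤ toFun y τ
  le : ∀ (x : WithTop (Grade r)) (ε : ℝ≥0), x ≤ toFun x ε
  lax : ∀ (x : WithTop (Grade r)) (ε τ : ℝ≥0), toFun (toFun x ε) τ ≤ toFun x (ε + τ)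

/-- The standard contour `C(x, ε) = x + ε v` in the direction of `v`. -/
noncomputable def standardContour {r : ℕ} (v : Grade r) : Contour r where
  toFun x ε := x + ((ε • v : Grade r) : WithTop (Grade r))
  mono {x y ε τ} hxy hετ := by
    refine add_le_add hxy (WithTop.coe_le_coe.2 fun i => ?_)
    exact mul_le_mul_left hετ (v i)
  le x ε := le_self_add
  lax x ε τ := by
    rw [add_assoc, ← WithTop.coe_add, ← add_smul]

section Noise

variable {K : Type u} [Field K] {r : ℕ}

/-- The noise system of a contour: the `ε`-th component consists of the tame modules `N` such that
`N(x ≤ C(x, ε))` is zero whenever `C(x, ε) ≠ ∞`. -/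
def contourNoise (K : Type u) [Field K] {r : ℕ} (C : Contour r) (ε : ℝ≥0) : Set (PersMod K r) :=
  {N | IsTame N ∧ ∀ (x y : Grade r) (hxy : x ≤ y),
    C.toFun (x : WithTop (Grade r)) ε = (y : WithTop (Grade r)) → N.map (homOfLE hxy) = 0}

/-- The standard noise in the direction of `v`. -/
def standardNoise (K : Type u) [Field K] {r : ℕ} (v : Grade r) : ℝ≥0 → Set (PersMod K r) :=
  contourNoise K (standardContour v)

/-- With respect to a noise system `V`, a morphism `f` is an `ε`-equivalence if `ker f ∈ V a` and
`coker f ∈ V b` for some `a`, `b` with `a + b ≤ ε`. -/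
def IsEquivalence (V : ℝ≥0 → Set (PersMod K r)) (ε : ℝ≥0) {M N : PersMod K r}
    (f : M ⟶ N) : Prop :=
  ∃ a b : ℝ≥0, a + b ≤ ε ∧ Limits.kernel f ∈ V a ∧ Limits.cokernel f ∈ V b

/-- Tame modules `M`, `N` are `ε`-equivalent if there are a tame module `L` and an
`ε₁`-equivalence `M ⟶ L` and an `ε₂`-equivalence `N ⟶ L` with `ε₁ + ε₂ ≤ ε`. -/
def AreEquivalent (V : ℝ≥0 → Set (PersMod K r)) (ε : ℝ≥0) (M N : TameMod K r) : Prop :=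
  ∃ (L : TameMod K r) (f : M.1 ⟶ L.1) (g : N.1 ⟶ L.1) (ε₁ ε₂ : ℝ≥0),
    IsEquivalence V ε₁ f ∧ IsEquivalence V ε₂ g ∧ ε₁ + ε₂ ≤ ε

/-- The extended pseudometric of a noise system: the infimum of all `ε` such that `M` and `N` are
`ε`-equivalent (and `∞` if there are none). -/
noncomputable def noiseDist (V : ℝ≥0 → Set (PersMod K r)) (M N : TameMod K r) : ℝ≥0∞ :=
  ⨅ (ε : ℝ≥0) (_ : AreEquivalent V ε M N), (ε : ℝ≥0∞)

end Noise

/-- The hierarchical stabilization of `f : T → ℕ` with respect to an extended pseudometric `d`: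
`x ↦ (τ ↦ min {f y | d x y ≤ τ})`. -/
noncomputable def hierStab {T : Type*} (d : T → T → ℝ≥0∞) (f : T → ℕ) (x : T) (τ : ℝ≥0) : ℕ :=
  sInf {n : ℕ | ∃ y : T, d x y ≤ (τ : ℝ≥0∞) ∧ f y = n}

/-- The normalization `w / ‖w‖` of a vector `w ∈ 𝐑^r` for a norm on `ℝ^r`. -/
noncomputable def normalize {r : ℕ} (nrm : Seminorm ℝ (Fin r → ℝ)) (w : Grade r) : Grade r :=
  (Real.toNNReal (nrm fun i => (w i : ℝ)))⁻¹ • w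

end MultiPers

/-! For `≤`, take elements attaining `dim_{δv}(M)`. The submodule they generate includes injectively
into `M`, and its cokernel is killed by `δv`, so it is within distance `δ`; its `β₀` is at most the
number of generators (`exists_noiseDist_le_of_vGenerate`).

For `≥`, let `d(M, N) ≤ δ`. Along `M → L ← N`, push the minimal generators of `N` to `L`, shift them
until they lift to `M`, and add up the shifts: `M` is `ηv`-generated by `β₀(N)` elements for every
admissible `η` (`exists_vGenerate_of_areEquivalent`). The infimum `δ` need not be admissible, so `η`
may exceed `δ`. This excess is removed by a grid: a tame module is constant on half-open cells with
finitely many corners, and after the generators are moved to corners so is the submodule they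
generate. For `η` close enough to `δ`, every corner shifted by `ηv` or `δv` lands in the same cell,
so the smaller shift suffices (`exists_vGenerate_of_noiseDist_le`).

The grid also gives tameness: grid-constant modules with finite-dimensional fibers are finitely
presented. -/

namespace MultiPers

/-! ### Elementwise calculus of persistence modules, kernels and cokernels -/

section Transition

variable {K : Type u} [Field K] {r : ℕ}

/-- The transition map `M(a) → M(b)` of a persistence module, as a linear map. -/
def tr (M : PersMod K r) {a b : Grade r} (h : a ≤ b) : M.obj a →ₗ[K] M.obj b :=
  (M.map (homOfLE h)).hom

theorem tr_tr (M : PersMod K r) {a b c : Grade r} (h : a ≤ b) (h' : b ≤ c) (x : M.obj a) :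
    tr M h' (tr M h x) = tr M (h.trans h') x := by
  change (M.map (homOfLE h')) (M.map (homOfLE h) x) = M.map (homOfLE _) x
  rw [← ConcreteCategory.comp_apply, ← M.map_comp]
  rfl

theorem tr_self (M : PersMod K r) {a : Grade r} (h : a ≤ a) (x : M.obj a) : tr M h x = x := by
  change (M.map (𝟙 a)) x = x
  rw [M.map_id]
  rfl

theorem app_tr {M N : PersMod K r} (f : M ⟶ N) {a b : Grade r} (h : a ≤ b) (x : M.obj a) :
    (f.app b).hom (tr M h x) = tr N h ((f.app a).hom x) := by
  change (f.app b) (M.map (homOfLE h) x) = N.map (homOfLE h) (f.app a x)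
  rw [← ConcreteCategory.comp_apply, ← ConcreteCategory.comp_apply, f.naturality]

theorem map_eq_zero_iff (M : PersMod K r) {a b : Grade r} (h : a ≤ b) :
    M.map (homOfLE h) = 0 ↔ ∀ x, tr M h x = 0 := by
  constructor
  · intro h0 x
    simp [tr, h0]
  · intro h0
    ext x
    exact h0 x

theorem PersSub.tr_mem {M : PersMod K r} (U : PersSub M) {a b : Grade r} (h : a ≤ b) {x : M.obj a}
    (hx : x ∈ U.fiber a) : tr M h x ∈ U.fiber b :=
  U.fiber_le_comap (homOfLE h) hx

/-- A persistence submodule as a persistence module. -/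
def PersSub.toMod {M : PersMod K r} (U : PersSub M) : PersMod K r where
  obj h := ModuleCat.of K (U.fiber h)
  map f := ModuleCat.ofHom ((M.map f).hom.restrict fun _ hx => U.fiber_le_comap f hx)
  map_id h := by
    refine ModuleCat.hom_ext (LinearMap.ext fun (x : U.fiber h) => Subtype.ext ?_)
    change (M.map (𝟙 h)) x.1 = x.1
    rw [M.map_id]
    rfl
  map_comp {h _ _} f f' := by
    refine ModuleCat.hom_ext (LinearMap.ext fun (x : U.fiber h) => Subtype.ext ?_)
    change (M.map (f ≫ f')) x.1 = M.map f' (M.map f x.1)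
    rw [M.map_comp]
    rfl

/-- The inclusion of a persistence submodule. -/
def PersSub.ι {M : PersMod K r} (U : PersSub M) : U.toMod ⟶ M where
  app h := ModuleCat.ofHom (U.fiber h).subtype
  naturality _ _ _ := rfl

/-- The kernel of a morphism as a persistence submodule. -/
def kerSub {M N : PersMod K r} (f : M ⟶ N) : PersSub M where
  fiber h := LinearMap.ker (f.app h).hom
  fiber_le_comap {h h'} i x hx := by
    have := app_tr f (leOfHom i) x
    rw [LinearMap.mem_ker.1 hx, map_zero] at this
    exact this

theorem vGenerate_iff (v : Grade r) (M : PersMod K r) {k : ℕ} (g : Fin k → Grade r)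
    (m : ∀ i, M.obj (g i)) :
    VGenerate v M g m ↔ ∀ (a : Grade r) (x : M.obj a),
      tr M (le_self_add : a ≤ a + v) x ∈ (generated M g m).fiber (a + v) := by
  refine forall_congr' fun a => (map_eq_zero_iff _ _).trans ?_
  constructor
  · intro h x
    exact (Submodule.Quotient.mk_eq_zero _).1 (h (Submodule.Quotient.mk x))
  · intro h x
    induction x using Submodule.Quotient.induction_on with
    | _ x => exact (Submodule.Quotient.mk_eq_zero _).2 (h x)

/-- Evaluation at a degree is exact, so the categorical kernel is computed degreewise. -/
theorem exists_of_kernel {M N : PersMod K r} (f : M ⟶ N) {h : Grade r} {x : M.obj h}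
    (hx : (f.app h).hom x = 0) :
    ∃ y : (Limits.kernel f).obj h, ((Limits.kernel.ι f).app h).hom y = x := by
  have h1 := (ShortComplex.exact_kernel f).map ((evaluation (Grade r) (ModuleCat.{u} K)).obj h)
  rw [ShortComplex.moduleCat_exact_iff] at h1
  exact h1 x hx

theorem kernel_ι_injective {M N : PersMod K r} (f : M ⟶ N) (h : Grade r) :
    Function.Injective ((Limits.kernel.ι f).app h).hom :=
  (ModuleCat.mono_iff_injective _).1 inferInstance

theorem range_eq_ker_cokernel {M N : PersMod K r} (f : M ⟶ N) (h : Grade r) :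
    LinearMap.range (f.app h).hom = LinearMap.ker ((Limits.cokernel.π f).app h).hom := by
  have h1 := (ShortComplex.exact_cokernel f).map ((evaluation (Grade r) (ModuleCat.{u} K)).obj h)
  exact (ShortComplex.moduleCat_exact_iff_range_eq_ker _).1 h1

theorem cokernel_π_isSurj {M N : PersMod K r} (f : M ⟶ N) : IsSurj (Limits.cokernel.π f) :=
  fun _ => (ModuleCat.epi_iff_surjective _).1 inferInstance

end Transition

/-! ### Free modules and generators -/

section Free

variable {K : Type u} [Field K] {r : ℕ}

theorem tr_mem_generated (M : PersMod K r) {k : ℕ} (g : Fin k → Grade r) (m : ∀ i, M.obj (g i))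
    {h : Grade r} (i : Fin k) (hi : g i ≤ h) : tr M hi (m i) ∈ (generated M g m).fiber h :=
  Submodule.subset_span ⟨i, hi, rfl⟩

theorem generated_le {M : PersMod K r} {k : ℕ} {g : Fin k → Grade r} {m : ∀ i, M.obj (g i)}
    {h : Grade r} {W : Submodule K (M.obj h)} (hW : ∀ i (hi : g i ≤ h), tr M hi (m i) ∈ W) :
    (generated M g m).fiber h ≤ W := by
  refine Submodule.span_le.2 ?_
  rintro y ⟨i, hi, rfl⟩
  exact hW i hi

open Classical in
/-- The image of `x ∈ M(a)` in `M(h)`, zero if there is no transition map. -/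
noncomputable def trOrZero (M : PersMod K r) (a h : Grade r) (x : M.obj a) : M.obj h :=
  if ha : a ≤ h then tr M ha x else 0

theorem trOrZero_of_le (M : PersMod K r) {a h : Grade r} (ha : a ≤ h) (x : M.obj a) :
    trOrZero M a h x = tr M ha x := dif_pos ha

/-- The component in degree `h` of the morphism of a free module determined by the images of the
free generators. -/
noncomputable def freeHomApp (M : PersMod K r) {n : ℕ} (g : Fin n → Grade r)
    (m : ∀ i, M.obj (g i)) (h : Grade r) : freeFiber K g h →ₗ[K] M.obj h :=
  (∑ i, (LinearMap.proj i : (Fin n → K) →ₗ[K] K).smulRight (trOrZero M (g i) h (m i))) ∘ₗ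
    (freeFiber K g h).subtype

theorem freeHomApp_apply (M : PersMod K r) {n : ℕ} (g : Fin n → Grade r)
    (m : ∀ i, M.obj (g i)) (h : Grade r) (c : freeFiber K g h) :
    freeHomApp M g m h c = ∑ i, c.1 i • trOrZero M (g i) h (m i) := by
  simp [freeHomApp]

/-- The morphism of a free module determined by the images of the free generators. -/
noncomputable def freeHom (M : PersMod K r) {n : ℕ} (g : Fin n → Grade r)
    (m : ∀ i, M.obj (g i)) : freeMod K g ⟶ M where
  app h := ModuleCat.ofHom (freeHomApp M g m h)
  naturality {h h'} f := by
    refine ModuleCat.hom_ext (LinearMap.ext fun (c : freeFiber K g h) => ?_)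
    change freeHomApp M g m h' (Submodule.inclusion (freeFiber_mono g (leOfHom f)) c)
      = tr M (leOfHom f) (freeHomApp M g m h c)
    rw [freeHomApp_apply, freeHomApp_apply, map_sum]
    refine Finset.sum_congr rfl fun i _ => ?_
    rw [map_smul, Submodule.coe_inclusion]
    by_cases hi : g i ≤ h
    · rw [trOrZero_of_le M hi, trOrZero_of_le M (hi.trans (leOfHom f)), tr_tr]
    · rw [c.2 i hi, zero_smul, zero_smul]

theorem single_mem_freeFiber {n : ℕ} (g : Fin n → Grade r) {h : Grade r} {i : Fin n}
    (hi : g i ≤ h) (a : K) : Pi.single i a ∈ freeFiber K g h := by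
  intro j hj
  have : j ≠ i := by
    rintro rfl
    exact hj hi
  simp [this]

theorem generated_le_range_freeHom (M : PersMod K r) {n : ℕ} (g : Fin n → Grade r)
    (m : ∀ i, M.obj (g i)) (h : Grade r) :
    (generated M g m).fiber h ≤ LinearMap.range ((freeHom M g m).app h).hom := by
  refine generated_le fun i hi => ⟨⟨Pi.single i 1, single_mem_freeFiber g hi 1⟩, ?_⟩
  change freeHomApp M g m h _ = _
  rw [freeHomApp_apply, Finset.sum_eq_single i]
  · simp [trOrZero_of_le M hi]
  · intro j _ hj
    simp [hj]
  · simp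

theorem exists_range_le_generated {M : PersMod K r} {n : ℕ} {g : Fin n → Grade r}
    (p : freeMod K g ⟶ M) : ∃ m : ∀ i, M.obj (g i), ∀ h,
      LinearMap.range (p.app h).hom ≤ (generated M g m).fiber h := by
  let e : ∀ i, freeFiber K g (g i) := fun i => ⟨Pi.single i 1, single_mem_freeFiber g le_rfl 1⟩
  refine ⟨fun i => (p.app (g i)).hom (e i), fun h => ?_⟩
  let P : freeFiber K g h →ₗ[K] M.obj h := (p.app h).hom
  rintro _ ⟨(c : freeFiber K g h), rfl⟩
  change P c ∈ _
  have hs : ∀ i, Pi.single i (c.1 i) ∈ freeFiber K g h := by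
    intro i
    by_cases hi : g i ≤ h
    · exact single_mem_freeFiber g hi _
    · rw [c.2 i hi, Pi.single_zero]
      exact Submodule.zero_mem _
  -- Each summand is either the transported `i`-th generator times a scalar, or zero because `g i ≤
  -- h` fails.
  have hc : c = ∑ i, (⟨Pi.single i (c.1 i), hs i⟩ : freeFiber K g h) := by
    apply Subtype.ext
    rw [AddSubmonoidClass.coe_finsetSum]
    exact (Finset.univ_sum_single c.1).symm
  rw [hc, map_sum]
  refine Submodule.sum_mem _ fun i _ => ?_
  by_cases hi : g i ≤ h
  · have : (⟨Pi.single i (c.1 i), hs i⟩ : freeFiber K g h)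
        = c.1 i • Submodule.inclusion (freeFiber_mono g hi) (e i) := by
      apply Subtype.ext
      change (Pi.single i (c.1 i) : Fin n → K) = c.1 i • (Pi.single i 1 : Fin n → K)
      rw [← Pi.single_smul, smul_eq_mul, mul_one]
    rw [this, map_smul]
    exact Submodule.smul_mem _ _
      (Set.mem_of_eq_of_mem (app_tr p hi (e i)) (tr_mem_generated M g _ i hi))
  · have : (⟨Pi.single i (c.1 i), hs i⟩ : freeFiber K g h) = 0 := by
      apply Subtype.ext
      change (Pi.single i (c.1 i) : Fin n → K) = 0
      rw [c.2 i hi, Pi.single_zero]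
    rw [this, map_zero]
    exact Submodule.zero_mem _

end Free

/-! ### Finite grids, grid-constant modules and tameness -/

section Grid

variable {K : Type u} [Field K] {r : ℕ}

/-- The lower corner of the cell of `a` in the grid with coordinates in `S` (and zero). -/
noncomputable def corner (S : Finset ℝ≥0) (a : Grade r) : Grade r :=
  fun i => (S.filter (· ≤ a i)).sup id

theorem corner_le (S : Finset ℝ≥0) (a : Grade r) : corner S a ≤ a :=
  fun _ => Finset.sup_le fun _ hs => (Finset.mem_filter.1 hs).2

theorem corner_of_mem {S : Finset ℝ≥0} {a : Grade r} (ha : ∀ i, a i ∈ S) : corner S a = a :=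
  le_antisymm (corner_le S a) fun i =>
    Finset.le_sup (f := id) (Finset.mem_filter.2 ⟨ha i, le_rfl⟩)

theorem corner_congr {S : Finset ℝ≥0} {a b : Grade r}
    (h : ∀ i, ∀ s ∈ S, s ≤ a i ↔ s ≤ b i) : corner S a = corner S b := by
  funext i
  unfold corner
  rw [Finset.filter_congr (h i)]

theorem corner_mono (S : Finset ℝ≥0) {a b : Grade r} (h : a ≤ b) : corner S a ≤ corner S b :=
  fun i => Finset.sup_mono
    (Finset.monotone_filter_right S fun _ _ hs => le_trans hs (h i))

theorem corner_corner (S : Finset ℝ≥0) (a : Grade r) : corner S (corner S a) = corner S a :=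
  corner_congr fun i _ hs =>
    ⟨fun h => h.trans (corner_le S a i),
      fun h => Finset.le_sup (f := id) (Finset.mem_filter.2 ⟨hs, h⟩)⟩

theorem finite_range_corner (S : Finset ℝ≥0) : (Set.range (corner S : Grade r → Grade r)).Finite := by
  refine (Set.Finite.pi' (ι := Fin r) (t := fun _ => (↑(insert 0 S) : Set ℝ≥0))
    fun _ => Finset.finite_toSet _).subset ?_
  rintro _ ⟨a, rfl⟩ i
  change (S.filter (· ≤ a i)).sup id ∈ (↑(insert 0 S) : Set ℝ≥0)
  rcases (S.filter (· ≤ a i)).eq_empty_or_nonempty with h | h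
  · rw [h]
    simp
  · obtain ⟨s, hs, hs'⟩ := Finset.exists_mem_eq_sup _ h id
    rw [hs']
    exact Finset.mem_coe.2 (Finset.mem_insert_of_mem (Finset.mem_filter.1 hs).1)

/-- Cells are closed below and open above: an inequality `s ≤ a i + δ * v i` survives increasing
`δ`, and its strict failure is an open condition. -/
theorem eventually_corner_add_smul (S : Finset ℝ≥0) (v a : Grade r) (δ : ℝ≥0) :
    ∀ᶠ ε in nhdsWithin δ (Set.Ioi δ), corner S (a + ε • v) = corner S (a + δ • v) := by
  have key : ∀ᶠ ε in nhdsWithin δ (Set.Ioi δ), ∀ i : Fin r, ∀ s ∈ S,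
      (s ≤ a i + ε * v i ↔ s ≤ a i + δ * v i) := by
    rw [Filter.eventually_all]
    intro i
    rw [Filter.eventually_all_finset]
    intro s _
    by_cases hs : s ≤ a i + δ * v i
    · filter_upwards [self_mem_nhdsWithin] with ε hε
      have : δ * v i ≤ ε * v i := mul_le_mul_left (le_of_lt hε) (v i)
      exact ⟨fun _ => hs, fun _ => hs.trans (add_le_add le_rfl this)⟩
    · have hc : Continuous fun ε : ℝ≥0 => a i + ε * v i := by fun_prop
      filter_upwards [nhdsWithin_le_nhds
        (hc.continuousAt.eventually (gt_mem_nhds (not_le.1 hs)))] with ε hε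
      exact ⟨fun h => absurd h (not_le.2 hε), fun h => absurd h hs⟩
  filter_upwards [key] with ε hε
  exact corner_congr hε

/-- One `ε` serves all degrees because there are only finitely many corners. -/
theorem exists_gt_corner_add_smul (S : Finset ℝ≥0) (v : Grade r) (δ : ℝ≥0) :
    ∃ ε, δ < ε ∧ ∀ a : Grade r,
      corner S (corner S a + ε • v) = corner S (corner S a + δ • v) := by
  have h : ∀ᶠ ε in nhdsWithin δ (Set.Ioi δ), ∀ b ∈ Set.range (corner S : Grade r → Grade r),
      corner S (b + ε • v) = corner S (b + δ • v) :=
    (Filter.eventually_all_finite (finite_range_corner S)).2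
      fun b _ => eventually_corner_add_smul S v b δ
  obtain ⟨ε, hε, hε'⟩ := (h.and self_mem_nhdsWithin).exists
  exact ⟨ε, hε', fun a => hε _ ⟨a, rfl⟩⟩

/-- `M` is constant on the cells of the grid with coordinates in `S`. -/
def IsConst (S : Finset ℝ≥0) (M : PersMod K r) : Prop :=
  ∀ a : Grade r, Function.Bijective (tr M (corner_le S a))

theorem IsConst.injective {S : Finset ℝ≥0} {M : PersMod K r} (hM : IsConst S M) {a b : Grade r}
    (h : a ≤ b) (hab : corner S a = corner S b) : Function.Injective (tr M h) := by
  -- The corner is generalized to a variable `c`, so that the equality of corners can be used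
  -- without transporting along dependent types.
  have key : ∀ (c : Grade r) (hc : c ≤ a), c = corner S a → ∀ z : M.obj a, ∃ y, tr M hc y = z := by
    rintro _ hc rfl z
    exact (hM a).2 z
  have key' : ∀ (c : Grade r) (hc : c ≤ b), c = corner S b → Function.Injective (tr M hc) := by
    rintro _ hc rfl
    exact (hM b).1
  intro x y hxy
  obtain ⟨x, rfl⟩ := key _ (corner_le S a) rfl x
  obtain ⟨y, rfl⟩ := key _ (corner_le S a) rfl y
  rw [tr_tr, tr_tr] at hxy
  rw [key' _ _ hab hxy]

/-- A generator at a grid point lies below `a` exactly when it lies below the corner of `a`. -/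
theorem isConst_freeMod {S : Finset ℝ≥0} {n : ℕ} {g : Fin n → Grade r}
    (hg : ∀ i, corner S (g i) = g i) : IsConst S (freeMod K g) := by
  refine fun a => ⟨fun x y hxy => ?_, fun x => ?_⟩
  · apply Subtype.ext
    exact congrArg (fun z : freeFiber K g a => z.1) hxy
  · refine ⟨⟨x.1, fun i hi => x.2 i fun h => hi ?_⟩, rfl⟩
    rw [← hg i]
    exact corner_mono S h

theorem IsConst.of_exact {S : Finset ℝ≥0} {A B C : PersMod K r} (hA : IsConst S A)
    (hB : IsConst S B) (q : A ⟶ B) (p : B ⟶ C) (hp : IsSurj p)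
    (hqp : ∀ h, LinearMap.range (q.app h).hom = LinearMap.ker (p.app h).hom) : IsConst S C := by
  refine fun a => ⟨?_, fun x => ?_⟩
  · rw [injective_iff_map_eq_zero]
    intro x hx
    obtain ⟨y, rfl⟩ := hp _ x
    rw [← app_tr] at hx
    have hy : tr B (corner_le S a) y ∈ LinearMap.range (q.app a).hom := by
      rw [hqp]
      exact hx
    obtain ⟨z, hz⟩ := hy
    obtain ⟨z, rfl⟩ := (hA a).2 z
    rw [app_tr] at hz
    have : y ∈ LinearMap.range (q.app (corner S a)).hom := ⟨z, (hB a).1 hz⟩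
    rw [hqp] at this
    exact this
  · obtain ⟨y, rfl⟩ := hp _ x
    obtain ⟨y, rfl⟩ := (hB a).2 y
    exact ⟨(p.app _).hom y, (app_tr p _ y).symm⟩

theorem IsConst.toMod {S : Finset ℝ≥0} {M : PersMod K r} (hM : IsConst S M) (U : PersSub M)
    (hU : ∀ a x, tr M (corner_le S a) x ∈ U.fiber a → x ∈ U.fiber (corner S a)) :
    IsConst S U.toMod := by
  refine fun a => ⟨fun x y hxy => ?_, fun x => ?_⟩
  · apply Subtype.ext
    exact (hM a).1 (congrArg (fun z : U.fiber a => z.1) hxy)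
  · obtain ⟨y, hy⟩ := (hM a).2 x.1
    refine ⟨⟨y, hU a y ?_⟩, Subtype.ext hy⟩
    rw [hy]
    exact x.2

theorem IsConst.kerSub {S : Finset ℝ≥0} {M N : PersMod K r} (hM : IsConst S M) (hN : IsConst S N)
    (f : M ⟶ N) : IsConst S (kerSub f).toMod := by
  refine hM.toMod _ fun a x hx => (hN a).1 ?_
  rw [← app_tr, map_zero]
  exact hx

/-- No generator is born between two degrees of one cell, so the fiber at `b` is covered by the
fiber at `a`; injectivity of the transition then pulls membership back. -/
theorem IsConst.mem_generated_of_tr_mem {S : Finset ℝ≥0} {M : PersMod K r} (hM : IsConst S M)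
    {k : ℕ} {g : Fin k → Grade r} (hg : ∀ i, corner S (g i) = g i) (m : ∀ i, M.obj (g i))
    {a b : Grade r} (h : a ≤ b) (hab : corner S a = corner S b) {x : M.obj a}
    (hx : tr M h x ∈ (generated M g m).fiber b) : x ∈ (generated M g m).fiber a := by
  have hle : (generated M g m).fiber b ≤ ((generated M g m).fiber a).map (tr M h) := by
    refine generated_le fun i hi => ?_
    have hia : g i ≤ a := by
      rw [← hg i]
      exact (corner_mono S hi).trans (hab.symm.le.trans (corner_le S a))
    exact ⟨tr M hia (m i), tr_mem_generated M g m i hia, tr_tr _ _ _ _⟩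
  obtain ⟨y, hy, hyx⟩ := hle hx
  rwa [← hM.injective h hab hyx]

theorem IsConst.generated {S : Finset ℝ≥0} {M : PersMod K r} (hM : IsConst S M)
    {k : ℕ} {g : Fin k → Grade r} (hg : ∀ i, corner S (g i) = g i) (m : ∀ i, M.obj (g i)) :
    IsConst S (generated M g m).toMod :=
  hM.toMod _ fun a _ hx => hM.mem_generated_of_tr_mem hg m (corner_le S a) (corner_corner S a) hx

/-- Every element comes from the corner of its cell, so finite spanning sets at the finitely many
corners generate. -/
theorem IsConst.exists_free_cover {S : Finset ℝ≥0} {M : PersMod K r} (hM : IsConst S M)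
    (hfin : ∀ a, Module.Finite K (M.obj a)) :
    ∃ (n : ℕ) (g : Fin n → Grade r) (p : freeMod K g ⟶ M),
      IsSurj p ∧ ∀ i, corner S (g i) = g i := by
  choose n s hs using fun a => Module.Finite.exists_fin (R := K) (M := M.obj a)
  have := (finite_range_corner (r := r) S).fintype
  let e := Fintype.equivFin (Σ x : Set.range (corner S : Grade r → Grade r), Fin (n x.1))
  refine ⟨_, fun j => (e.symm j).1.1,
    freeHom M _ fun j => s (e.symm j).1.1 (e.symm j).2, fun h => ?_, fun j => ?_⟩
  · intro x
    refine generated_le_range_freeHom M _ _ h ?_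
    obtain ⟨y, rfl⟩ := (hM h).2 x
    have hy : y ∈ Submodule.span K (Set.range (s (corner S h))) := by
      rw [hs]
      exact Submodule.mem_top
    rw [← Submodule.mem_comap]
    refine Submodule.span_le.2 ?_ hy
    rintro _ ⟨t, rfl⟩
    let σ : Σ x : Set.range (corner S : Grade r → Grade r), Fin (n x.1) :=
      ⟨⟨corner S h, Set.mem_range_self h⟩, t⟩
    refine Submodule.subset_span ⟨e σ, ?_, ?_⟩
    · change (e.symm (e σ)).1.1 ≤ h
      rw [Equiv.symm_apply_apply]
      exact corner_le S h
    · have key : ∀ (z : Σ x : Set.range (corner S : Grade r → Grade r), Fin (n x.1))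
          (hz : z = σ) (hle : z.1.1 ≤ h),
          tr M (corner_le S h) (s (corner S h) t) = tr M hle (s z.1.1 z.2) := by
        rintro _ rfl _
        rfl
      exact key _ (Equiv.symm_apply_apply e _) _
  · obtain ⟨a, ha⟩ := (e.symm j).1.2
    change corner S (e.symm j).1.1 = (e.symm j).1.1
    rw [← ha, corner_corner]

theorem finite_freeMod {n : ℕ} (g : Fin n → Grade r) (a : Grade r) :
    Module.Finite K ((freeMod K g).obj a) :=
  inferInstanceAs (Module.Finite K (freeFiber K g a))

theorem finite_toMod {M : PersMod K r} (hfin : ∀ a, Module.Finite K (M.obj a)) (U : PersSub M)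
    (a : Grade r) : Module.Finite K (U.toMod.obj a) :=
  have := hfin a
  inferInstanceAs (Module.Finite K (U.fiber a))

theorem finite_of_isSurj {M N : PersMod K r} (hfin : ∀ a, Module.Finite K (M.obj a)) {p : M ⟶ N}
    (hp : IsSurj p) (a : Grade r) : Module.Finite K (N.obj a) :=
  have := hfin a
  Module.Finite.of_surjective (p.app a).hom (hp a)

/-- The kernel of a grid-aligned free cover is again grid-constant with finite-dimensional fibers,
so covering it as well gives a presentation. -/
theorem IsConst.isTame {S : Finset ℝ≥0} {M : PersMod K r} (hM : IsConst S M)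
    (hfin : ∀ a, Module.Finite K (M.obj a)) : IsTame M := by
  obtain ⟨n, g, p, hp, hg⟩ := hM.exists_free_cover hfin
  obtain ⟨n', g', q, hq, -⟩ := ((isConst_freeMod hg).kerSub hM p).exists_free_cover
    (finite_toMod (finite_freeMod g) _)
  refine ⟨n, n', g, g', q ≫ (MultiPers.kerSub p).ι, p, hp, fun h => ?_⟩
  apply le_antisymm
  · rintro _ ⟨z, rfl⟩
    exact ((q.app h).hom z).2
  · intro x hx
    obtain ⟨z, hz⟩ := hq h ⟨x, hx⟩
    exact ⟨z, congrArg Subtype.val hz⟩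

theorem IsTame.finite {M : PersMod K r} (hM : IsTame M) (a : Grade r) :
    Module.Finite K (M.obj a) := by
  obtain ⟨n, m, g, g', q, p, hp, -⟩ := hM
  exact finite_of_isSurj (finite_freeMod g) hp a

/-- The grid consists of all coordinates of generators and relations. Allowing every larger `T`
makes room for the degrees of further elements. -/
theorem IsTame.exists_isConst {M : PersMod K r} (hM : IsTame M) :
    ∃ S : Finset ℝ≥0, ∀ T, S ⊆ T → IsConst T M := by
  classical
  obtain ⟨n, m, g, g', q, p, hp, hqp⟩ := hM
  refine ⟨(Finset.univ.image fun x : Fin n × Fin r => g x.1 x.2) ∪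
    Finset.univ.image fun x : Fin m × Fin r => g' x.1 x.2, fun T hT => ?_⟩
  refine (isConst_freeMod (g := g') fun i => corner_of_mem fun j => hT ?_).of_exact
    (isConst_freeMod (g := g) fun i => corner_of_mem fun j => hT ?_) q p hp hqp
  · exact Finset.mem_union_right _ (Finset.mem_image.2 ⟨(i, j), Finset.mem_univ _, rfl⟩)
  · exact Finset.mem_union_left _ (Finset.mem_image.2 ⟨(i, j), Finset.mem_univ _, rfl⟩)

theorem isTame_of_subsingleton {M : PersMod K r} (hM : ∀ a, Subsingleton (M.obj a)) :
    IsTame M := by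
  refine IsConst.isTame (S := ∅) (fun a => ?_) fun a => ?_
  · have := hM a
    have := hM (corner ∅ a)
    exact ⟨Function.injective_of_subsingleton _, Function.surjective_to_subsingleton _⟩
  · have := hM a
    infer_instance

theorem exists_isConst_generated {M : PersMod K r} (hM : IsTame M) {k : ℕ} (g : Fin k → Grade r)
    (m : ∀ i, M.obj (g i)) : ∃ S, IsConst S M ∧ IsConst S (generated M g m).toMod := by
  classical
  obtain ⟨S, hS⟩ := hM.exists_isConst
  have hT := hS (S ∪ Finset.univ.image fun x : Fin k × Fin r => g x.1 x.2)
    Finset.subset_union_left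
  exact ⟨_, hT, hT.generated (fun i => corner_of_mem fun j => Finset.mem_union_right _
    (Finset.mem_image.2 ⟨(i, j), Finset.mem_univ _, rfl⟩)) m⟩

end Grid

/-! ### The two inequalities -/

section Stabilization

variable {K : Type u} [Field K] {r : ℕ}

theorem mem_standardNoise {v : Grade r} {ε : ℝ≥0} {N : PersMod K r} :
    N ∈ standardNoise K v ε ↔ IsTame N ∧
      ∀ (a : Grade r) (x : N.obj a), tr N (le_self_add : a ≤ a + ε • v) x = 0 := by
  refine and_congr_right fun _ => ⟨fun h a => ?_, fun h a b hab hb => ?_⟩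
  · exact (map_eq_zero_iff _ _).1 (h a (a + ε • v) le_self_add rfl)
  · obtain rfl : a + ε • v = b := WithTop.coe_injective hb
    exact (map_eq_zero_iff _ _).2 (h a)

theorem mem_standardNoise_of_subsingleton {v : Grade r} {ε : ℝ≥0} {N : PersMod K r}
    (hN : ∀ a, Subsingleton (N.obj a)) : N ∈ standardNoise K v ε := by
  refine mem_standardNoise.2 ⟨isTame_of_subsingleton hN, fun a x => ?_⟩
  have := hN (a + ε • v)
  exact Subsingleton.elim _ _

theorem subsingleton_kernel {M N : PersMod K r} {f : M ⟶ N}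
    (hf : ∀ h, Function.Injective (f.app h).hom) (a : Grade r) :
    Subsingleton ((Limits.kernel f).obj a) := by
  refine subsingleton_of_forall_eq 0 fun x => kernel_ι_injective f a (hf a ?_)
  rw [map_zero, map_zero]
  have : (Limits.kernel.ι f ≫ f).app a = 0 := by
    rw [Limits.kernel.condition]
    rfl
  exact congrArg (fun t => t.hom x) this

theorem subsingleton_cokernel {M N : PersMod K r} {f : M ⟶ N} (hf : IsSurj f) (a : Grade r) :
    Subsingleton ((Limits.cokernel f).obj a) := by
  refine subsingleton_of_forall_eq 0 fun x => ?_
  obtain ⟨y, rfl⟩ := cokernel_π_isSurj f a x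
  rw [← LinearMap.mem_ker, ← range_eq_ker_cokernel]
  exact hf a y

/-- A submodule that `δ v`-generates a tame module is `δ`-close to it. -/
theorem exists_noiseDist_le_of_vGenerate {v : Grade r} {δ : ℝ≥0} (M : TameMod K r) {k : ℕ}
    {g : Fin k → Grade r} {m : ∀ i, M.1.obj (g i)} (hm : VGenerate (δ • v) M.1 g m) :
    ∃ N : TameMod K r, noiseDist (standardNoise K v) M N ≤ δ ∧ betti0 N.1 ≤ k := by
  obtain ⟨S, hS, hSU⟩ := exists_isConst_generated M.2 g m
  rw [vGenerate_iff] at hm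
  have hι : ∀ h, Function.Injective ((generated M.1 g m).ι.app h).hom :=
    fun h => Subtype.val_injective
  refine ⟨⟨(generated M.1 g m).toMod, hSU.isTame (finite_toMod M.2.finite _)⟩, ?_, ?_⟩
  -- The common target is `M` itself; only the cokernel of the inclusion costs anything, namely `δ`.
  · refine iInf₂_le δ ⟨M, 𝟙 _, (generated M.1 g m).ι, 0, δ, ⟨0, 0, by simp, ?_, ?_⟩,
      ⟨0, δ, by simp, ?_, ?_⟩, by simp⟩
    · exact mem_standardNoise_of_subsingleton (subsingleton_kernel fun _ _ _ h => h)
    · exact mem_standardNoise_of_subsingleton (subsingleton_cokernel fun _ x => ⟨x, rfl⟩)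
    · exact mem_standardNoise_of_subsingleton (subsingleton_kernel hι)
    · refine mem_standardNoise.2 ⟨?_, fun a x => ?_⟩
      · exact (hSU.of_exact hS _ _ (cokernel_π_isSurj _) (range_eq_ker_cokernel _)).isTame
          (finite_of_isSurj M.2.finite (cokernel_π_isSurj _))
      · obtain ⟨y, rfl⟩ := cokernel_π_isSurj _ a x
        rw [← app_tr, ← LinearMap.mem_ker, ← range_eq_ker_cokernel]
        exact ⟨⟨_, hm a y⟩, rfl⟩
  · refine Nat.sInf_le ⟨g, freeHom _ g fun i => ⟨m i, ?_⟩, fun h x => ?_⟩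
    · have := tr_mem_generated M.1 g m i (le_refl (g i))
      rwa [tr_self] at this
    · refine generated_le_range_freeHom _ _ _ h ?_
      have hle : (generated M.1 g m).fiber h ≤
          Submodule.map ((generated M.1 g m).ι.app h).hom
            ((generated (generated M.1 g m).toMod g fun i => ⟨m i, by
              have := tr_mem_generated M.1 g m i (le_refl (g i))
              rwa [tr_self] at this⟩).fiber h) :=
        generated_le fun i hi => ⟨_, tr_mem_generated _ g _ i hi, rfl⟩
      obtain ⟨y, hy, hyx⟩ := hle x.2
      rwa [← hι h hyx]

/-- Generators are transported along an equivalence, at the cost of a shift. -/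
theorem exists_vGenerate_of_areEquivalent {v : Grade r} {ε : ℝ≥0} {M N : TameMod K r}
    (h : AreEquivalent (standardNoise K v) ε M N) :
    ∃ (g : Fin (betti0 N.1) → Grade r) (m : ∀ i, M.1.obj (g i)),
      VGenerate (ε • v) M.1 g m := by
  obtain ⟨L, f, g, ε₁, ε₂, ⟨a, b, hab, hkf, hcf⟩, ⟨c, d, hcd, -, hcg⟩, hε⟩ := h
  have hne : {n : ℕ | ∃ (g : Fin n → Grade r) (p : freeMod K g ⟶ N.1), IsSurj p}.Nonempty := by
    obtain ⟨n, -, g, -, -, p, hp, -⟩ := N.2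
    exact ⟨n, g, p, hp⟩
  obtain ⟨γ, p, hp⟩ := Nat.sInf_mem hne
  change Fin (betti0 N.1) → Grade r at γ
  obtain ⟨n, hn⟩ := exists_range_le_generated p
  have hcok : ∀ {A : PersMod K r} (φ : A ⟶ L.1) {t : ℝ≥0},
      Limits.cokernel φ ∈ standardNoise K v t → ∀ (s : Grade r) (x : L.1.obj s),
      ∃ y, (φ.app _).hom y = tr L.1 (le_self_add : s ≤ s + t • v) x := by
    intro A φ t ht s x
    have := (mem_standardNoise.1 ht).2 s (((Limits.cokernel.π φ).app s).hom x)
    rwa [← app_tr, ← LinearMap.mem_ker, ← range_eq_ker_cokernel] at this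
  -- Since `b • v` kills `coker f`, the images in `L` of the generators of `N` lift to `M` after
  -- this shift.
  choose m hm using fun i => hcok f hcf (γ i) ((g.app _).hom (n i))
  refine ⟨fun i => γ i + b • v, m, (vGenerate_iff _ _ _ _).2 fun s x => ?_⟩
  have hle : ∀ s, (generated N.1 γ n).fiber s ≤ Submodule.comap
      (tr L.1 (le_self_add : s ≤ s + b • v) ∘ₗ (g.app s).hom)
      (((generated M.1 (fun i => γ i + b • v) m).fiber (s + b • v)).map (f.app _).hom) := by
    refine fun s => generated_le fun i hi => ?_
    have hi' : γ i + b • v ≤ s + b • v := add_le_add hi le_rfl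
    refine ⟨tr M.1 hi' (m i), tr_mem_generated M.1 (fun i => γ i + b • v) m i hi', ?_⟩
    rw [app_tr, hm, LinearMap.comp_apply, app_tr, tr_tr, tr_tr]
  -- Shifting `f x` by `d • v` lifts it to `N`, and a further `b • v` gives `z` in the generated
  -- submodule with the same image in `L` as the shifted `x`. Their difference lies in `ker f`,
  -- which `a • v` kills; the total shift is `d + b + a ≤ ε`.
  obtain ⟨y, hy⟩ := hcok g hcg s ((f.app s).hom x)
  obtain ⟨z, hz, hzy⟩ := hle _ (hn _ (hp _ y))
  rw [LinearMap.comp_apply, hy, ← app_tr, ← app_tr, tr_tr] at hzy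
  obtain ⟨k, hk⟩ := exists_of_kernel f (x := tr M.1 (le_self_add.trans le_self_add :
    s ≤ s + d • v + b • v) x - z) (by rw [map_sub, hzy, sub_self])
  have hk0 := congrArg ((Limits.kernel.ι f).app _).hom ((mem_standardNoise.1 hkf).2 _ k)
  rw [app_tr, hk, map_zero, map_sub, sub_eq_zero, tr_tr] at hk0
  have hmem := (generated M.1 (fun i => γ i + b • v) m).tr_mem
    (le_self_add : s + d • v + b • v ≤ s + d • v + b • v + a • v) hz
  rw [← hk0] at hmem
  have hle' : s + d • v + b • v + a • v ≤ s + ε • v := by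
    rw [add_assoc, add_assoc, ← add_smul, ← add_smul]
    refine add_le_add le_rfl fun i => ?_
    refine mul_le_mul_left ?_ (v i)
    calc d + (b + a) ≤ (a + b) + (c + d) := by
          rw [add_comm d, add_comm b a]
          exact add_le_add le_rfl le_add_self
      _ ≤ ε := (add_le_add hab hcd).trans hε
  have := (generated M.1 (fun i => γ i + b • v) m).tr_mem hle' hmem
  rwa [tr_tr] at this

/-- Generators of a tame module up to a slightly larger shift can be moved to the corners of a
grid, where they generate up to the given shift. -/
theorem exists_vGenerate_of_noiseDist_le {v : Grade r} {δ : ℝ≥0} {M N : TameMod K r}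
    (h : noiseDist (standardNoise K v) M N ≤ δ) :
    ∃ (g : Fin (betti0 N.1) → Grade r) (m : ∀ i, M.1.obj (g i)),
      VGenerate (δ • v) M.1 g m := by
  obtain ⟨S, hS⟩ := M.2.exists_isConst
  replace hS := hS S subset_rfl
  obtain ⟨ε, hδε, hε⟩ := exists_gt_corner_add_smul S v δ
  obtain ⟨η, hη, hηε⟩ : ∃ η : ℝ≥0, AreEquivalent (standardNoise K v) η M N ∧ η < ε := by
    have := h.trans_lt (ENNReal.coe_lt_coe.2 hδε)
    simp only [noiseDist, iInf_lt_iff] at this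
    obtain ⟨η, hη, hlt⟩ := this
    exact ⟨η, hη, ENNReal.coe_lt_coe.1 hlt⟩
  obtain ⟨g, m, hgm⟩ := exists_vGenerate_of_areEquivalent hη
  rw [vGenerate_iff] at hgm
  choose m' hm' using fun i => (hS (g i)).2 (m i)
  refine ⟨fun i => corner S (g i), m', (vGenerate_iff _ _ _ _).2 fun a x => ?_⟩
  have hsub : ∀ s, (generated M.1 g m).fiber s ≤
      (generated M.1 (fun i => corner S (g i)) m').fiber s := by
    refine fun s => generated_le fun i hi => ?_
    rw [← hm', tr_tr]
    exact tr_mem_generated M.1 (fun i => corner S (g i)) m' i _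
  -- It suffices to start from the corner of `a`, where `hε` compares the two shifts.
  obtain ⟨y, rfl⟩ := (hS a).2 x
  have hsmul : ∀ {t t' : ℝ≥0}, t ≤ t' → corner S a + t • v ≤ corner S a + t' • v :=
    fun ht => add_le_add le_rfl fun i => mul_le_mul_left ht (v i)
  have h1 := (generated M.1 (fun i => corner S (g i)) m').tr_mem (hsmul hηε.le)
    (hsub _ (hgm _ y))
  rw [tr_tr, ← tr_tr M.1 le_self_add (hsmul hδε.le)] at h1
  -- Both shifts of the corner lie in one cell, so membership descends from `ε • v` to `δ • v`.
  have h2 := hS.mem_generated_of_tr_mem (fun i => corner_corner S (g i)) m' _ (hε a).symm h1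
  have h3 := (generated M.1 (fun i => corner S (g i)) m').tr_mem
    (add_le_add (corner_le S a) le_rfl : corner S a + δ • v ≤ a + δ • v) h2
  rw [tr_tr] at h3 ⊢
  exact h3

end Stabilization

end MultiPers

theorem mainTheorem1 {K : Type u} [Field K] {r : ℕ}
    (nrm : Seminorm ℝ (Fin r → ℝ)) (hnrm : ∀ x : Fin r → ℝ, nrm x = 0 → x = 0)
    (w : MultiPers.Grade r) (hw : w ≠ 0) (v : MultiPers.Grade r)
    (hv : v = MultiPers.normalize nrm w)
    (M : MultiPers.TameMod K r) (δ : ℝ≥0) :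
    MultiPers.hierStab
        (MultiPers.noiseDist (MultiPers.standardNoise K v))
        (fun N : MultiPers.TameMod K r => MultiPers.betti0 N.1) M δ
      = MultiPers.shiftDim (δ • v) M.1 := by
  -- `sInf ∅ = 0` in `ℕ`, so attaining the minimum needs a witness: the generators of a presentation
  -- generate `M` outright.
  have hne : {k : ℕ | ∃ (g : Fin k → MultiPers.Grade r) (m : ∀ i, M.1.obj (g i)),
      MultiPers.VGenerate (δ • v) M.1 g m}.Nonempty := by
    obtain ⟨n, -, g, -, -, p, hp, -⟩ := M.2
    obtain ⟨m, hm⟩ := MultiPers.exists_range_le_generated p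
    exact ⟨n, g, m, (MultiPers.vGenerate_iff _ _ _ _).2 fun a x => hm _ (hp _ _)⟩
  obtain ⟨g, m, hgm⟩ := Nat.sInf_mem hne
  obtain ⟨N, hN, hNk⟩ := MultiPers.exists_noiseDist_le_of_vGenerate M hgm
  have hmem : MultiPers.betti0 N.1 ∈ {n : ℕ | ∃ y : MultiPers.TameMod K r,
      MultiPers.noiseDist (MultiPers.standardNoise K v) M y ≤ (δ : ℝ≥0∞) ∧
        MultiPers.betti0 y.1 = n} := ⟨N, hN, rfl⟩
  refine le_antisymm ((Nat.sInf_le hmem).trans hNk) ?_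
  obtain ⟨N', hN', hN'eq⟩ := Nat.sInf_mem ⟨_, hmem⟩
  exact (Nat.sInf_le (MultiPers.exists_vGenerate_of_noiseDist_le hN')).trans hN'eq.le
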